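/- Let $\mathscr{P}$ be an additive category and let $\mathbf{K}\mathscr{P}$ be the homotopy category of complexes $\cdots\to C_{n+1}\to C_n\to C_{n-1}\to\cdots$ in $\mathscr{P}$ $(n\in\mathbb{Z})$, with its usual triangulated structure (suspension and mapping cones). A complex $C$ in $\mathscr{P}$ is called totally acyclic if the complexes of abelian groups $\mathrm{Hom}_{\mathscr{P}}(P,C)$ and $\mathrm{Hom}_{\mathscr{P}}(C,P)$ are acyclic for every object $P$ of $\mathscr{P}$; it is called eventually acyclic if for every object $P$ of $\mathscr{P}$ one has $H_n(\mathrm{Hom}_{\mathscr{P}}(P,C))=0$ for $|n|\gg 0$. Let $\mathbf{K}_{\mathrm{tac}}(\mathscr{P})$, $\mathbf{K}^{-,\mathrm{b}}(\mathscr{P})$ and $\mathbf{K}^{\mathrm{b}}(\mathscr{P})$ be the full triangulated subcategories of $\mathbf{K}\mathscr{P}$ consisting of the objects isomorphic in $\mathbf{K}\mathscr{P}$, respectively, to a totally acyclic complex, to an eventually acyclic complex $C$ with $C_n=0$ for $n\ll 0$, and to a complex $C$ with $C_n=0$ for $|n|\gg 0$. Let $\mathbf{K}^{-,\mathrm{b}}(\mathscr{P})/\mathbf{K}^{\mathrm{b}}(\mathscr{P})$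 be the Verdier quotient. For a complex $C$, let $\beta_{\ge 0}(C)$ be its brutal truncation $\cdots\to C_2\to C_1\to C_0\to 0\to 0\to\cdots$, and for a chain map $f$ let $\beta_{\ge 0}(f)$ be the induced chain map of truncations. Then there is a triangle functor $$\beta_{\mathscr{P}}\colon \mathbf{K}_{\mathrm{tac}}(\mathscr{P})\to \mathbf{K}^{-,\mathrm{b}}(\mathscr{P})/\mathbf{K}^{\mathrm{b}}(\mathscr{P})$$ induced by brutal truncation at degree zero, that is, it sends every totally acyclic complex $C$ to the image of $\beta_{\ge 0}(C)$ in the quotient and the homotopy class of every chain map $f$ between totally acyclic complexes to the image of $\beta_{\ge 0}(f)$ (in particular the latter depends only on the homotopy class of $f$). The functor $\beta_{\mathscr{P}}$ is fully faithful. -/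

import Mathlib

open CategoryTheory CategoryTheory.Limits Opposite

open scoped ZeroObject

universe v u

set_option linter.unusedSectionVars false

noncomputable section

/-!
Complexes are written cohomologically, as `CochainComplex P ℤ`; the homologically indexed complex
`⋯ ⟶ C_{n+1} ⟶ C_n ⟶ C_{n-1} ⟶ ⋯` is the cochain complex `C` with `C.X i = C_{-i}`.
-/

namespace BrutalTruncation

section Preadditive

variable (P : Type u) [Category.{v} P] [Preadditive P]

variable {P} in
/-- The complex of abelian groups `Hom(A, C)`. -/
abbrev homFrom (A : P) (C : CochainComplex P ℤ) :
    HomologicalComplex AddCommGrpCat.{v} (ComplexShape.up ℤ) :=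
  ((preadditiveCoyoneda.obj (op A)).mapHomologicalComplex (ComplexShape.up ℤ)).obj C

variable {P} in
/-- The complex of abelian groups `Hom(C, A)`. -/
abbrev homTo (C : CochainComplex P ℤ) (A : P) :
    HomologicalComplex AddCommGrpCat.{v} (ComplexShape.up ℤ).symm :=
  ((preadditiveYoneda.obj A).mapHomologicalComplex (ComplexShape.up ℤ).symm).obj
    (HomologicalComplex.op C)

/-- `C` is totally acyclic: `Hom(A, C)` and `Hom(C, A)` are acyclic for all objects `A`. -/
def totallyAcyclic : ObjectProperty (CochainComplex P ℤ) := fun C =>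
  (∀ A : P, (homFrom A C).Acyclic) ∧ (∀ A : P, (homTo C A).Acyclic)

/-- `C` is eventually acyclic: for each object `A`, the homology of `Hom(A, C)` vanishes in
degrees of large absolute value. -/
def eventuallyAcyclic : ObjectProperty (CochainComplex P ℤ) := fun C =>
  ∀ A : P, ∃ N : ℕ, ∀ n : ℤ, (N : ℤ) < |n| → (homFrom A C).ExactAt n

/-- `C_n = 0` for `n ≪ 0`, i.e. `C.X i = 0` for `i ≫ 0`. -/
def boundedRight : ObjectProperty (CochainComplex P ℤ) := fun C =>
  ∃ N : ℤ, ∀ i : ℤ, N < i → IsZero (C.X i)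

/-- `C_n = 0` for `|n| ≫ 0`. -/
def bounded : ObjectProperty (CochainComplex P ℤ) := fun C =>
  ∃ N : ℤ, ∀ i : ℤ, N < |i| → IsZero (C.X i)

/-- The homotopy category of all complexes. -/
abbrev K := HomotopyCategory P (ComplexShape.up ℤ)

/-- The objects of the homotopy category isomorphic to a totally acyclic complex. -/
def tac : ObjectProperty (K P) :=
  (totallyAcyclic P).map (HomotopyCategory.quotient P (ComplexShape.up ℤ))

/-- The objects of the homotopy category isomorphic to a right bounded, eventually acyclic
complex. -/
def minusB : ObjectProperty (K P) :=
  (boundedRight P ⊓ eventuallyAcyclic P).map (HomotopyCategory.quotient P (ComplexShape.up ℤ))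

/-- The objects of the homotopy category isomorphic to a bounded complex. -/
def bdd : ObjectProperty (K P) :=
  (bounded P).map (HomotopyCategory.quotient P (ComplexShape.up ℤ))

instance : (tac P).IsClosedUnderIsomorphisms := by unfold tac; infer_instance
instance : (minusB P).IsClosedUnderIsomorphisms := by unfold minusB; infer_instance
instance : (bdd P).IsClosedUnderIsomorphisms := by unfold bdd; infer_instance

variable {P}

lemma exactAt_homFrom_iff (A : P) (C : CochainComplex P ℤ) (n : ℤ) :
    (homFrom A C).ExactAt n ↔
      ∀ x : A ⟶ C.X n, x ≫ C.d n (n + 1) = 0 → ∃ y : A ⟶ C.X (n - 1), y ≫ C.d (n - 1) n = x := by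
  rw [HomologicalComplex.exactAt_iff' _ (n - 1) n (n + 1) (by simp) (by simp),
    ShortComplex.ab_exact_iff]
  rfl

lemma exactAt_homTo_iff (A : P) (C : CochainComplex P ℤ) (n : ℤ) :
    (homTo C A).ExactAt n ↔
      ∀ x : C.X n ⟶ A, C.d (n - 1) n ≫ x = 0 → ∃ y : C.X (n + 1) ⟶ A, C.d n (n + 1) ≫ y = x := by
  rw [HomologicalComplex.exactAt_iff' _ (n + 1) n (n - 1)
    ((ComplexShape.up ℤ).symm.prev_eq' (by simp)) ((ComplexShape.up ℤ).symm.next_eq' (by simp)),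
    ShortComplex.ab_exact_iff]
  rfl

end Preadditive

section Additive

variable (P : Type u) [Category.{v} P] [Preadditive P] [HasZeroObject P] [HasBinaryBiproducts P]

variable {P}

/-- The class in the homotopy category of an object placed in one degree. -/
abbrev stalk (A : P) (n : ℤ) : K P :=
  (HomotopyCategory.quotient P (ComplexShape.up ℤ)).obj
    ((CochainComplex.singleFunctor P n).obj A)

open CochainComplex HomComplex in
lemma exactAt_homFrom_iff_stalk (A : P) (C : CochainComplex P ℤ) (n : ℤ) :
    (homFrom A C).ExactAt n ↔
      ∀ f : stalk A n ⟶ (HomotopyCategory.quotient P (ComplexShape.up ℤ)).obj C, f = 0 := by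
  rw [exactAt_homFrom_iff]
  constructor
  · intro h f
    obtain ⟨f, rfl⟩ := (HomotopyCategory.quotient P (ComplexShape.up ℤ)).map_surjective f
    obtain ⟨g, hg, hg'⟩ := Cocycle.fromSingleMk_surjective (Cocycle.ofHom f) n (add_zero n)
      (n + 1) rfl
    obtain ⟨y, hy⟩ := h g hg
    rw [HomotopyCategory.quotient_map_eq_zero_iff]
    have : Cocycle.ofHom f ∈ coboundaries _ _ _ := by
      rw [← hg', Cocycle.fromSingleMk_mem_coboundaries_iff _ _ _ _ _ (n - 1) (by simp)]
      exact ⟨y, hy⟩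
    rw [mem_coboundaries_iff _ (-1) (by simp)] at this
    obtain ⟨b, hb⟩ := this
    exact ⟨(Cochain.equivHomotopy f 0).symm ⟨b, by simpa using hb.symm⟩⟩
  · intro h x hx
    let z := Cocycle.fromSingleMk x (add_zero n) (n + 1) rfl hx
    have h1 := h ((HomotopyCategory.quotient P (ComplexShape.up ℤ)).map (Cocycle.homOf z))
    rw [HomotopyCategory.quotient_map_eq_zero_iff] at h1
    obtain ⟨ho⟩ := h1
    rw [← Cocycle.fromSingleMk_mem_coboundaries_iff x (add_zero n) (n + 1) rfl hx
      (n - 1) (by simp), mem_coboundaries_iff _ (-1) (by simp)]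
    obtain ⟨b, hb⟩ := Cochain.equivHomotopy _ _ ho
    exact ⟨b, by simpa [z] using hb.symm⟩

open CochainComplex HomComplex in
lemma exactAt_homTo_iff_stalk (A : P) (C : CochainComplex P ℤ) (n : ℤ) :
    (homTo C A).ExactAt n ↔
      ∀ f : (HomotopyCategory.quotient P (ComplexShape.up ℤ)).obj C ⟶ stalk A n, f = 0 := by
  rw [exactAt_homTo_iff]
  constructor
  · intro h f
    obtain ⟨f, rfl⟩ := (HomotopyCategory.quotient P (ComplexShape.up ℤ)).map_surjective f
    obtain ⟨g, hg, hg'⟩ := Cocycle.toSingleMk_surjective (Cocycle.ofHom f) n (add_zero n)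
      (n - 1) (by simp)
    obtain ⟨y, hy⟩ := h g hg
    rw [HomotopyCategory.quotient_map_eq_zero_iff]
    have : Cocycle.ofHom f ∈ coboundaries _ _ _ := by
      rw [← hg', Cocycle.toSingleMk_mem_coboundaries_iff _ _ _ _ _ (n + 1) (by simp)]
      exact ⟨y, hy⟩
    rw [mem_coboundaries_iff _ (-1) (by simp)] at this
    obtain ⟨b, hb⟩ := this
    exact ⟨(Cochain.equivHomotopy f 0).symm ⟨b, by simpa using hb.symm⟩⟩
  · intro h x hx
    let z := Cocycle.toSingleMk x (add_zero n) (n - 1) (by simp) hx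
    have h1 := h ((HomotopyCategory.quotient P (ComplexShape.up ℤ)).map (Cocycle.homOf z))
    rw [HomotopyCategory.quotient_map_eq_zero_iff] at h1
    obtain ⟨ho⟩ := h1
    rw [← Cocycle.toSingleMk_mem_coboundaries_iff x (add_zero n) (n - 1) (by simp) hx
      (n + 1) (by simp), mem_coboundaries_iff _ (-1) (by simp)]
    obtain ⟨b, hb⟩ := Cochain.equivHomotopy _ _ ho
    exact ⟨b, by simpa [z] using hb.symm⟩

variable (P) in
/-- The stalk complexes, up to isomorphism. -/
def stalks : ObjectProperty (K P) := fun X => ∃ (A : P) (n : ℤ), Nonempty (X ≅ stalk A n)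

/-- A shift of a stalk complex is a stalk complex. -/
def stalkShift (A : P) (n a m : ℤ) (h : a + m = n) :
    (shiftFunctor (K P) a).obj (stalk A n) ≅ stalk A m :=
  ((HomotopyCategory.singleFunctors P).shiftIso a m n h).app A

instance : (stalks P).IsStableUnderShift ℤ where
  isStableUnderShiftBy a := ⟨by
    rintro X ⟨A, n, ⟨e⟩⟩
    exact ⟨A, n - a, ⟨(shiftFunctor (K P) a).mapIso e ≪≫ stalkShift A n a (n - a) (by simp)⟩⟩⟩

lemma totallyAcyclic_iff (C : CochainComplex P ℤ) :
    totallyAcyclic P C ↔ ((stalks P).rightOrthogonal ⊓ (stalks P).leftOrthogonal)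
      ((HomotopyCategory.quotient P (ComplexShape.up ℤ)).obj C) := by
  simp only [totallyAcyclic, HomologicalComplex.Acyclic, exactAt_homFrom_iff_stalk,
    exactAt_homTo_iff_stalk]
  refine and_congr ⟨?_, ?_⟩ ⟨?_, ?_⟩
  · rintro h X f ⟨A, n, ⟨e⟩⟩
    rw [← cancel_epi e.inv, h A n (e.inv ≫ f), comp_zero]
  · exact fun h A n f => h f ⟨A, n, ⟨Iso.refl _⟩⟩
  · rintro h X f ⟨A, n, ⟨e⟩⟩
    rw [← cancel_mono e.hom, h A n (f ≫ e.hom), zero_comp]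
  · exact fun h A n f => h f ⟨A, n, ⟨Iso.refl _⟩⟩

variable (P) in
lemma tac_eq : tac P = (stalks P).rightOrthogonal ⊓ (stalks P).leftOrthogonal := by
  ext X
  constructor
  · rintro ⟨C, hC, ⟨e⟩⟩
    rw [totallyAcyclic_iff] at hC
    exact ObjectProperty.prop_of_iso _ e hC
  · intro hX
    obtain ⟨C, rfl⟩ := X.quotient_obj_surjective
    exact ⟨C, (totallyAcyclic_iff C).2 hX, ⟨Iso.refl _⟩⟩

instance : (tac P).IsTriangulated := by
  rw [tac_eq]
  infer_instance

/-- The property of objects of the homotopy category corresponding to eventual acyclicity. -/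
def eventuallyOrthogonal : ObjectProperty (K P) := fun X =>
  ∀ A : P, ∃ N : ℕ, ∀ n : ℤ, (N : ℤ) < |n| → ∀ f : stalk A n ⟶ X, f = 0

instance : (eventuallyOrthogonal (P := P)).IsClosedUnderIsomorphisms where
  of_iso e h A := by
    obtain ⟨N, hN⟩ := h A
    refine ⟨N, fun n hn f => ?_⟩
    rw [← cancel_mono e.inv, hN n hn (f ≫ e.inv), zero_comp]

instance : (eventuallyOrthogonal (P := P)).IsTriangulated where
  exists_zero := ⟨0, isZero_zero _, fun A => ⟨0, fun n _ f => (isZero_zero _).eq_of_tgt _ _⟩⟩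
  isStableUnderShiftBy a := ⟨by
    intro X h A
    obtain ⟨N, hN⟩ := h A
    refine ⟨N + a.natAbs, fun n hn f => ?_⟩
    apply (shiftFunctor (K P) (-a)).map_injective
    rw [Functor.map_zero, ← cancel_epi (stalkShift A n (-a) (n + a) (by simp)).inv,
      ← cancel_mono ((shiftFunctorCompIsoId (K P) a (-a) (by simp)).hom.app X), comp_zero, zero_comp]
    refine hN _ ?_ _
    push_cast at hn
    have := abs_sub_abs_le_abs_sub n (-a)
    rw [abs_neg, sub_neg_eq_add] at this
    linarith⟩
  toIsTriangulatedClosed₂ := .mk' (by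
    intro T hT h₁ h₃ A
    obtain ⟨N₁, hN₁⟩ := h₁ A
    obtain ⟨N₃, hN₃⟩ := h₃ A
    refine ⟨max N₁ N₃, fun n hn f => ?_⟩
    push_cast at hn
    obtain ⟨g, rfl⟩ := Pretriangulated.Triangle.coyoneda_exact₂ T hT f
      (hN₃ n (lt_of_le_of_lt (le_max_right _ _) hn) _)
    rw [hN₁ n (lt_of_le_of_lt (le_max_left _ _) hn) g, zero_comp])

lemma eventuallyAcyclic_iff (C : CochainComplex P ℤ) :
    eventuallyAcyclic P C ↔
      eventuallyOrthogonal ((HomotopyCategory.quotient P (ComplexShape.up ℤ)).obj C) := by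
  simp only [eventuallyAcyclic, exactAt_homFrom_iff_stalk]
  rfl

lemma isTriangulated_map_quotient (Q : ObjectProperty (CochainComplex P ℤ))
    (h0 : Q 0) (hs : ∀ (C : CochainComplex P ℤ) (a : ℤ), Q C → Q (C⟦a⟧))
    (hc : ∀ {C D : CochainComplex P ℤ} (f : C ⟶ D), Q C → Q D →
      Q (CochainComplex.mappingCone f)) :
    (Q.map (HomotopyCategory.quotient P (ComplexShape.up ℤ))).IsTriangulated where
  exists_zero := ⟨_, (HomotopyCategory.quotient P (ComplexShape.up ℤ)).map_isZero (isZero_zero _),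
    ⟨0, h0, ⟨Iso.refl _⟩⟩⟩
  isStableUnderShiftBy a := ⟨by
    rintro X ⟨C, hC, ⟨e⟩⟩
    exact ⟨C⟦a⟧, hs C a hC,
      ⟨((HomotopyCategory.quotient P (ComplexShape.up ℤ)).commShiftIso a).app C ≪≫
        (shiftFunctor (K P) a).mapIso e⟩⟩⟩
  toIsTriangulatedClosed₂ := .mk' (by
    rintro T hT ⟨C₁, hC₁, ⟨e₁⟩⟩ ⟨C₃, hC₃, ⟨e₃⟩⟩
    let q := HomotopyCategory.quotient P (ComplexShape.up ℤ)
    let e₃' : q.obj (C₃⟦(-1 : ℤ)⟧) ≅ T.invRotate.obj₁ :=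
      (q.commShiftIso (-1 : ℤ)).app C₃ ≪≫ (shiftFunctor (K P) (-1 : ℤ)).mapIso e₃
    let e₁' : q.obj C₁ ≅ T.invRotate.obj₂ := e₁
    obtain ⟨f, hf⟩ := q.map_surjective (e₃'.hom ≫ T.invRotate.mor₁ ≫ e₁'.inv)
    refine ⟨CochainComplex.mappingCone f, hc f (hs _ _ hC₃) hC₁, ⟨?_⟩⟩
    exact Pretriangulated.Triangle.π₃.mapIso (Pretriangulated.isoTriangleOfIso₁₂ _ T.invRotate
      (HomotopyCategory.mappingCone_triangleh_distinguished f)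
      (Pretriangulated.inv_rot_of_distTriang _ hT) e₃' e₁' (by
        change q.map f ≫ e₁'.hom = e₃'.hom ≫ T.invRotate.mor₁
        rw [hf, Category.assoc, Category.assoc, Iso.inv_hom_id, Category.comp_id])))

instance isTriangulated_boundedRight :
    ((boundedRight P).map (HomotopyCategory.quotient P (ComplexShape.up ℤ))).IsTriangulated := by
  refine isTriangulated_map_quotient _ ?_ ?_ ?_
  · exact ⟨0, fun i _ => (HomologicalComplex.eval P (ComplexShape.up ℤ) i).map_isZero
      (isZero_zero _)⟩
  · rintro C a ⟨N, hN⟩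
    exact ⟨N - a, fun i hi => hN (i + a) (by linarith)⟩
  · rintro C D f ⟨N, hN⟩ ⟨M, hM⟩
    refine ⟨max N M, fun i hi => ?_⟩
    rw [CochainComplex.mappingCone.isZero_X_iff]
    exact ⟨hN _ (by grind), hM _ (by grind)⟩

variable (P) in
lemma minusB_eq : minusB P =
    (boundedRight P).map (HomotopyCategory.quotient P (ComplexShape.up ℤ)) ⊓
      eventuallyOrthogonal := by
  ext X
  constructor
  · rintro ⟨C, ⟨h₁, h₂⟩, ⟨e⟩⟩
    rw [eventuallyAcyclic_iff] at h₂
    exact ⟨⟨C, h₁, ⟨e⟩⟩, ObjectProperty.prop_of_iso _ e h₂⟩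
  · rintro ⟨⟨C, h₁, ⟨e⟩⟩, h₂⟩
    exact ⟨C, ⟨h₁, (eventuallyAcyclic_iff C).2 (ObjectProperty.prop_of_iso _ e.symm h₂)⟩, ⟨e⟩⟩

instance : (minusB P).IsTriangulated := by
  rw [minusB_eq]
  infer_instance

instance : (bdd P).IsTriangulated := by
  refine isTriangulated_map_quotient _ ?_ ?_ ?_
  · exact ⟨0, fun i _ => (HomologicalComplex.eval P (ComplexShape.up ℤ) i).map_isZero
      (isZero_zero _)⟩
  · rintro C a ⟨N, hN⟩
    exact ⟨N + |a|, fun i hi => hN (i + a) (by grind)⟩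
  · rintro C D f ⟨N, hN⟩ ⟨M, hM⟩
    refine ⟨max N M + 1, fun i hi => ?_⟩
    rw [CochainComplex.mappingCone.isZero_X_iff]
    exact ⟨hN _ (by grind), hM _ (by grind)⟩

variable (P)

/-- The homotopy category of totally acyclic complexes. -/
abbrev Ktac := (tac P).FullSubcategory

/-- The homotopy category of right bounded, eventually acyclic complexes. -/
abbrev KminusB := (minusB P).FullSubcategory

/-- The bounded complexes, as objects of `KminusB P`. -/
abbrev bddInMinusB : ObjectProperty (KminusB P) := (bdd P).inverseImage (minusB P).ι

/-- The Verdier quotient of `KminusB P` by the bounded complexes: the localization at the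
morphisms whose cone is (isomorphic to) a bounded complex. -/
abbrev VerdierQuotient := (bddInMinusB P).trW.Localization

/-- The natural functor from `KminusB P` to the Verdier quotient. -/
abbrev toVerdierQuotient : KminusB P ⥤ VerdierQuotient P := (bddInMinusB P).trW.Q

/-- Brutal truncation `β_{≥0}` at degree zero, on complexes: it keeps `C_n` for `n ≥ 0`, that is
`C.X i` for `i ≤ 0`, and replaces the other terms by zero. -/
abbrev brutalTrunc : CochainComplex P ℤ ⥤ CochainComplex P ℤ :=
  (ComplexShape.embeddingUpIntLE 0).stupidTruncFunctor P

variable {P}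

lemma stupidTrunc_d {ι ι' : Type*} {c : ComplexShape ι} {c' : ComplexShape ι'}
    (C : HomologicalComplex P c') (e : c.Embedding c') [e.IsRelIff] {a b : ι} {i j : ι'}
    (hi : e.f a = i) (hj : e.f b = j) :
    (C.stupidTrunc e).d i j ≫ (C.stupidTruncXIso e hj).hom =
      (C.stupidTruncXIso e hi).hom ≫ C.d i j := by
  subst hi hj
  simp [HomologicalComplex.stupidTruncXIso, HomologicalComplex.stupidTrunc,
    HomologicalComplex.extend_d_eq _ _ rfl rfl]
  erw [Category.assoc, Iso.inv_hom_id_assoc, Category.comp_id, Category.id_comp]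

lemma isZero_brutalTrunc_X (C : CochainComplex P ℤ) (i : ℤ) (hi : 0 < i) :
    IsZero (((brutalTrunc P).obj C).X i) :=
  C.isZero_stupidTrunc_X _ i ((ComplexShape.notMem_range_embeddingUpIntLE_iff 0 i).2 hi)

lemma exactAt_brutalTrunc (A : P) (C : CochainComplex P ℤ) (n : ℤ) (hn : n < 0)
    (h : (homFrom A C).ExactAt n) : (homFrom A ((brutalTrunc P).obj C)).ExactAt n := by
  have hf (i : ℤ) (hi : i ≤ 0) : (ComplexShape.embeddingUpIntLE 0).f (-i).toNat = i := by
    simp; lia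
  rw [exactAt_homFrom_iff] at h ⊢
  intro x hx
  let φ (i : ℤ) (hi : i ≤ 0) : ((brutalTrunc P).obj C).X i ≅ C.X i :=
    C.stupidTruncXIso _ (hf i hi)
  have hφ (i j : ℤ) (hi : i ≤ 0) (hj : j ≤ 0) :
      ((brutalTrunc P).obj C).d i j ≫ (φ j hj).hom = (φ i hi).hom ≫ C.d i j :=
    stupidTrunc_d C _ (hf i hi) (hf j hj)
  obtain ⟨y, hy⟩ := h (x ≫ (φ n (by lia)).hom) (by
    rw [Category.assoc, ← hφ n (n + 1) (by lia) (by lia), reassoc_of% hx, zero_comp])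
  refine ⟨y ≫ (φ (n - 1) (by lia)).inv, ?_⟩
  rw [← cancel_mono (φ n (by lia)).hom, Category.assoc, Category.assoc,
    hφ (n - 1) n (by lia) (by lia), Iso.inv_hom_id_assoc, hy]

lemma brutalTrunc_mem (C : CochainComplex P ℤ) (hC : totallyAcyclic P C) :
    minusB P ((HomotopyCategory.quotient P (ComplexShape.up ℤ)).obj ((brutalTrunc P).obj C)) := by
  refine ⟨_, ⟨⟨0, fun i hi => isZero_brutalTrunc_X C i hi⟩, fun A => ⟨0, fun n hn => ?_⟩⟩,
    ⟨Iso.refl _⟩⟩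
  rcases lt_trichotomy n 0 with h | rfl | h
  · exact exactAt_brutalTrunc A C n h (hC.1 A n)
  · simp at hn
  · rw [exactAt_homFrom_iff]
    exact fun x _ => ⟨0, (isZero_brutalTrunc_X C n h).eq_of_tgt _ _⟩

variable (P)

/-- The functor sending a totally acyclic complex to its class in the homotopy category. -/
abbrev toKtac : (totallyAcyclic P).FullSubcategory ⥤ Ktac P :=
  (tac P).lift ((totallyAcyclic P).ι ⋙ HomotopyCategory.quotient P (ComplexShape.up ℤ))
    (fun C => ⟨C.obj, C.property, ⟨Iso.refl _⟩⟩)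

/-- The functor sending a totally acyclic complex `C` to the image of `β_{≥0}(C)` in the Verdier
quotient, and a chain map `f` between such complexes to the image of `β_{≥0}(f)`. -/
abbrev truncToQuotient : (totallyAcyclic P).FullSubcategory ⥤ VerdierQuotient P :=
  (minusB P).lift ((totallyAcyclic P).ι ⋙ brutalTrunc P ⋙
      HomotopyCategory.quotient P (ComplexShape.up ℤ))
    (fun C => brutalTrunc_mem C.obj C.property) ⋙ toVerdierQuotient P

end Additive
end BrutalTruncation
end

namespace BrutalTruncation

open CochainComplex HomComplex Preadditive Pretriangulated

/-! ### Null-homotopies of maps into bounded below complexes. -/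

section Preadditive

variable {P : Type u} [Category.{v} P] [Preadditive P]

/-! Both categories embed in one larger quotient, that of `K P` by the complexes vanishing in very
negative cohomological degrees (`bddBelow`). Every map from a totally acyclic complex to such a
complex is null-homotopic (`nonempty_homotopy_zero`), so `Ktac P` embeds fully faithfully. The
quotient of `KminusB P` by bounded complexes embeds too: a map from a bounded below complex to an
object of `minusB P` factors through a bounded one (`exists_factorization`), which is Verdier's
criterion.

The projection `C ⟶ σ^{≤ 0} C` has the bounded below kernel `σ^{≥ 1} C`, split in each degree, so it
becomes a natural isomorphism in the large quotient (`trW_map_πStupidTrunc`). The two embeddings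
thus agree along truncation, and lifting the first through the second gives the functor. Full
faithfulness, exactness and independence of the homotopy representative all come from this lift. -/

lemma exists_extension_of_exactAt_homTo {K L : CochainComplex P ℤ}
    (f : K ⟶ L) (α : Cochain K L (-1)) (n m : ℤ) (hnm : n + 1 = m)
    (hK : (homTo K (L.X m)).ExactAt m)
    (hα : (δ (-1) 0 α).EqUpTo (Cochain.ofHom f) n) :
    ∃ h : K.X (n + 2) ⟶ L.X (n + 1),
      (δ (-1) 0 (α + Cochain.single h (-1))).EqUpTo (Cochain.ofHom f) m := by
  subst hnm
  -- `u` is the error of `α` in degree `n + 1`. The homotopy equation in degree `n` gives `d ≫ u =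
  -- 0`, so `u` factors through the next differential of `K`, and the factor is the correction. It
  -- enters `δ` only in degrees `n + 1` and `n + 2`.
  let u := f.f (n + 1) - α.v (n + 1) n (by lia) ≫ L.d n (n + 1) -
    K.d (n + 1) (n + 2) ≫ α.v (n + 2) (n + 1) (by lia)
  have hu : K.d n (n + 1) ≫ u = 0 := by
    have eq := hα n n (add_zero n) (by rfl)
    simp only [δ_v (-1) 0 (neg_add_cancel 1) α n n (add_zero _) (n - 1) (n + 1)
      (by lia) (by lia), Int.negOnePow_zero, one_smul, Cochain.ofHom_v] at eq
    simp only [u, comp_sub, HomologicalComplex.d_comp_d_assoc, zero_comp,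
      ← f.comm, ← eq, add_comp, Category.assoc, L.d_comp_d, comp_zero, zero_add, sub_self]
  obtain ⟨β, hβ⟩ : ∃ β : K.X (n + 2) ⟶ L.X (n + 1), K.d (n + 1) (n + 2) ≫ β = u := by
    rw [exactAt_homTo_iff] at hK
    have e₁ : n + 1 - 1 = n := by lia
    have e₂ : n + 1 + 1 = n + 2 := by lia
    rw [e₁, e₂] at hK
    exact hK u hu
  refine ⟨β, fun p q hpq hp => ?_⟩
  obtain rfl : p = q := by lia
  obtain hp | rfl := hp.lt_or_eq
  · rw [δ_add, Cochain.add_v, hα p p (by lia) (by lia), add_eq_left,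
      δ_v (-1) 0 (neg_add_cancel 1) _ p p hpq (p - 1) (p + 1) rfl rfl,
      Cochain.single_v_eq_zero _ _ _ _ _ (by lia),
      Cochain.single_v_eq_zero _ _ _ _ _ (by lia)]
    simp
  · rw [δ_v (-1) 0 (neg_add_cancel 1) _ (n + 1) (n + 1) (by lia) n (n + 2)
      (by lia) (by lia), Cochain.add_v,
      Cochain.single_v_eq_zero _ _ _ _ _ (by lia)]
    simp [hβ, u]

open Cochain.InductionUp in
/-- A morphism from a complex `K` such that all the complexes `Hom(K, A)` are acyclic to a
bounded below complex is homotopic to zero. -/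
lemma nonempty_homotopy_zero {K L : CochainComplex P ℤ} (f : K ⟶ L)
    (hK : ∀ A : P, (homTo K A).Acyclic) (d : ℤ) [L.IsStrictlyGE d] :
    Nonempty (Homotopy f 0) := by
  -- The bound starts at `d - 1` because `L` vanishes below `d`, so the zero cochain starts the
  -- induction.
  let X (n : ℕ) : Set (Cochain K L (-1)) :=
    Set.ofPred (fun α => (δ (-1) 0 α).EqUpTo (Cochain.ofHom f) (n + d - 1))
  let x₀ : X 0 := ⟨0, fun p q hpq hp ↦
    IsZero.eq_of_tgt (L.isZero_of_isStrictlyGE d _ (by lia)) _ _⟩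
  let φ (n : ℕ) (α : X n) : X (n + 1) :=
    ⟨_, (exists_extension_of_exactAt_homTo f α.1 (n + d - 1) ((n + 1 : ℕ) + d - 1)
      (by lia) (hK _ _) α.2).choose_spec⟩
  have hφ (k : ℕ) (x : X k) : (φ k x).1.EqUpTo x.1 (d + k) := fun p q hpq hp => by
    dsimp [φ]
    rw [add_eq_left, Cochain.single_v_eq_zero _ _ _ _ _ (by lia)]
  refine ⟨(Cochain.equivHomotopy f 0).symm ⟨limitSequence φ hφ x₀, ?_⟩⟩
  rw [Cochain.ofHom_zero, add_zero]
  ext n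
  -- The degree `n` part of `δ` involves the cochain in source degrees `n` and `n + 1`; from stage
  -- `k₀` on, both are final.
  let k₀ := (n - d + 1).toNat
  rw [← (sequence φ x₀ k₀).2 n n (add_zero n) (by lia),
    δ_v (-1) 0 (neg_add_cancel 1) _ n n (by lia) (n - 1) (n + 1) rfl (by lia),
    δ_v (-1) 0 (neg_add_cancel 1) _ n n (by lia) (n - 1) (n + 1) rfl (by lia),
    limitSequence_eqUpTo φ hφ x₀ k₀ n (n - 1) (by lia) (by lia),
    limitSequence_eqUpTo φ hφ x₀ k₀ (n + 1) n (by lia) (by lia)]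

end Preadditive

/-! ### Canonical maps to and from brutal truncations. -/

section StupidTrunc

variable {ι ι' : Type*} {c : ComplexShape ι} {c' : ComplexShape ι'}
  {C : Type u} [Category.{v} C] [Preadditive C] [HasZeroObject C]
  [HasBinaryBiproducts C]
  (K : HomologicalComplex C c') {L : HomologicalComplex C c'} (φ : K ⟶ L)

open HomologicalComplex

section

variable (e : c.Embedding c') [e.IsTruncLE]

open Classical in
/-- The projection to the stupid truncation when `e.IsTruncLE`. -/
noncomputable def πStupidTrunc : K ⟶ K.stupidTrunc e where
  f i' := if h : ∃ i, e.f i = i' then (K.stupidTruncXIso e h.choose_spec).inv else 0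
  comm' i' j' hij := by
    by_cases hj : ∃ j, e.f j = j'
    · have hi : ∃ i, e.f i = i' := by
        obtain ⟨j, rfl⟩ := hj
        exact e.mem_prev hij
      rw [dif_pos hi, dif_pos hj, Iso.inv_comp_eq, ← Category.assoc, Iso.eq_comp_inv,
        stupidTrunc_d K e hi.choose_spec hj.choose_spec]
    · exact (K.isZero_stupidTrunc_X e j' (by simpa using hj)).eq_of_tgt _ _

lemma πStupidTrunc_f {i : ι} {i' : ι'} (hi : e.f i = i') :
    (πStupidTrunc K e).f i' = (K.stupidTruncXIso e hi).inv := by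
  have h : ∃ i, e.f i = i' := ⟨i, hi⟩
  obtain rfl : h.choose = i := e.injective_f (h.choose_spec.trans hi.symm)
  exact dif_pos h

variable {K} in
lemma πStupidTrunc_naturality :
    φ ≫ πStupidTrunc L e = πStupidTrunc K e ≫ stupidTruncMap φ e := by
  ext i'
  by_cases hi : ∃ i, e.f i = i'
  · obtain ⟨i, hi⟩ := hi
    rw [comp_f, comp_f, πStupidTrunc_f _ _ hi, πStupidTrunc_f _ _ hi, Iso.comp_inv_eq,
      Category.assoc, stupidTruncMap_stupidTruncXIso_hom, Iso.inv_hom_id_assoc]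
  · exact (L.isZero_stupidTrunc_X e i' (by simpa using hi)).eq_of_tgt _ _

lemma isIso_πStupidTrunc [K.IsStrictlySupported e] : IsIso (πStupidTrunc K e) := by
  have (i' : ι') : IsIso ((πStupidTrunc K e).f i') := by
    by_cases hi : ∃ i, e.f i = i'
    · obtain ⟨i, hi⟩ := hi
      rw [πStupidTrunc_f _ _ hi]
      infer_instance
    · exact ⟨0, (K.isZero_X_of_isStrictlySupported e _ (by simpa using hi)).eq_of_src _ _,
        (K.isZero_stupidTrunc_X e i' (by simpa using hi)).eq_of_src _ _⟩
  exact Hom.isIso_of_components _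

end

section

variable (e : c.Embedding c') [e.IsTruncGE]

open Classical in
/-- The inclusion of the stupid truncation when `e.IsTruncGE`. -/
noncomputable def ιStupidTrunc : K.stupidTrunc e ⟶ K where
  f i' := if h : ∃ i, e.f i = i' then (K.stupidTruncXIso e h.choose_spec).hom else 0
  comm' i' j' hij := by
    by_cases hi : ∃ i, e.f i = i'
    · have hj : ∃ j, e.f j = j' := by
        obtain ⟨i, rfl⟩ := hi
        exact e.mem_next hij
      rw [dif_pos hi, dif_pos hj, stupidTrunc_d K e hi.choose_spec hj.choose_spec]
    · exact (K.isZero_stupidTrunc_X e i' (by simpa using hi)).eq_of_src _ _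

lemma ιStupidTrunc_f {i : ι} {i' : ι'} (hi : e.f i = i') :
    (ιStupidTrunc K e).f i' = (K.stupidTruncXIso e hi).hom := by
  have h : ∃ i, e.f i = i' := ⟨i, hi⟩
  obtain rfl : h.choose = i := e.injective_f (h.choose_spec.trans hi.symm)
  exact dif_pos h

end

end StupidTrunc

section Truncation

variable {P : Type u} [Category.{v} P] [Preadditive P] [HasZeroObject P] [HasBinaryBiproducts P]

/-- The short complex `σ^{≥ n + 1} K ⟶ K ⟶ σ^{≤ n} K` of brutal truncations. -/
noncomputable def stupidTruncShortComplex (K : CochainComplex P ℤ) (n : ℤ) :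
    ShortComplex (CochainComplex P ℤ) :=
  .mk (ιStupidTrunc K (ComplexShape.embeddingUpIntGE (n + 1)))
    (πStupidTrunc K (ComplexShape.embeddingUpIntLE n)) (by
      ext i
      by_cases hi : n < i
      · exact (K.isZero_stupidTrunc_X _ i
          ((ComplexShape.notMem_range_embeddingUpIntLE_iff n i).2 hi)).eq_of_tgt _ _
      · exact (K.isZero_stupidTrunc_X _ i
          ((ComplexShape.notMem_range_embeddingUpIntGE_iff (n + 1) i).2 (by lia))).eq_of_src _ _)

/-- In each degree one of the two maps is an isomorphism and the remaining term is zero. Degreewise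
splitting is what turns the sequence into a distinguished triangle of `K P`. -/
lemma nonempty_splitting_stupidTruncShortComplex (K : CochainComplex P ℤ) (n i : ℤ) :
    Nonempty ((stupidTruncShortComplex K n).map
      (HomologicalComplex.eval P (ComplexShape.up ℤ) i)).Splitting := by
  by_cases hi : n < i
  · have h : (ComplexShape.embeddingUpIntGE (n + 1)).f (i - (n + 1)).toNat = i := by
      simp; lia
    have : IsIso ((ιStupidTrunc K (ComplexShape.embeddingUpIntGE (n + 1))).f i) := by
      rw [ιStupidTrunc_f _ _ h]; infer_instance
    exact ⟨.ofIsIsoOfIsZero _ this (K.isZero_stupidTrunc_X _ i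
      ((ComplexShape.notMem_range_embeddingUpIntLE_iff n i).2 hi))⟩
  · have h : (ComplexShape.embeddingUpIntLE n).f (n - i).toNat = i := by
      simp; lia
    have : IsIso ((πStupidTrunc K (ComplexShape.embeddingUpIntLE n)).f i) := by
      rw [πStupidTrunc_f _ _ h]; infer_instance
    exact ⟨.ofIsZeroOfIsIso _ (K.isZero_stupidTrunc_X _ i
      ((ComplexShape.notMem_range_embeddingUpIntGE_iff (n + 1) i).2 (by lia))) this⟩

end Truncation

end BrutalTruncation

namespace BrutalTruncation

open scoped ZeroObject
open CochainComplex HomComplex Preadditive Pretriangulated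

variable {P : Type u} [Category.{v} P] [Preadditive P] [HasZeroObject P] [HasBinaryBiproducts P]

/-! ### Bounded below complexes: orthogonality and factorization. -/

variable (P) in
/-- The objects of the homotopy category isomorphic to a bounded below cochain complex. -/
abbrev bddBelow : ObjectProperty (K P) := (HomotopyCategory.plus P).isoClosure

lemma bddBelow_of_isStrictlyGE (C : CochainComplex P ℤ) (n : ℤ) [C.IsStrictlyGE n] :
    bddBelow P ((HomotopyCategory.quotient P (ComplexShape.up ℤ)).obj C) :=
  ObjectProperty.le_isoClosure _ _ ((HomotopyCategory.plus_quotient_obj_iff C).2 ⟨n, inferInstance⟩)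

lemma exists_of_bddBelow {X : K P} (hX : bddBelow P X) :
    ∃ (C : CochainComplex P ℤ) (n : ℤ), C.IsStrictlyGE n ∧
      Nonempty (X ≅ (HomotopyCategory.quotient P (ComplexShape.up ℤ)).obj C) := by
  obtain ⟨Y, hY, ⟨e⟩⟩ := hX
  obtain ⟨C, rfl⟩ := Y.quotient_obj_surjective
  obtain ⟨n, hn⟩ := (HomotopyCategory.plus_quotient_obj_iff C).1 hY
  exact ⟨C, n, hn, ⟨e⟩⟩

/-- Totally acyclic complexes are left orthogonal to bounded below cochain complexes. -/
lemma tac_le_leftOrthogonal : tac P ≤ (bddBelow P).leftOrthogonal := by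
  rintro X ⟨C, hC, ⟨e⟩⟩ Y f hY
  obtain ⟨D, n, _, ⟨e'⟩⟩ := exists_of_bddBelow hY
  obtain ⟨g, hg⟩ := (HomotopyCategory.quotient P (ComplexShape.up ℤ)).map_surjective
    (e.hom ≫ f ≫ e'.hom)
  obtain ⟨h⟩ := nonempty_homotopy_zero g hC.2 n
  rw [← cancel_epi e.hom, ← cancel_mono e'.hom, Category.assoc, ← hg,
    HomotopyCategory.eq_of_homotopy _ _ h]
  simp

/-- The projection to a brutal truncation has a bounded below cone. -/
lemma trW_map_πStupidTrunc (C : CochainComplex P ℤ) (n : ℤ) :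
    (bddBelow P).trW ((HomotopyCategory.quotient P (ComplexShape.up ℤ)).map
      (πStupidTrunc C (ComplexShape.embeddingUpIntLE n))) := by
  let S := stupidTruncShortComplex C n
  let σ (i : ℤ) := (nonempty_splitting_stupidTruncShortComplex C n i).some
  have hT : trianglehOfDegreewiseSplit S σ ∈ distTriang (K P) :=
    (HomotopyCategory.distinguished_iff_iso_trianglehOfDegreewiseSplit _).2 ⟨S, σ, ⟨Iso.refl _⟩⟩
  have : CochainComplex.IsStrictlyGE S.X₁ (n + 1) :=
    inferInstanceAs (HomologicalComplex.IsStrictlySupported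
      (C.stupidTrunc (ComplexShape.embeddingUpIntGE (n + 1))) _)
  exact ObjectProperty.trW.mk' _ hT (bddBelow_of_isStrictlyGE S.X₁ (n + 1))

lemma bounded_of_isStrictlyGE_of_isStrictlyLE (C : CochainComplex P ℤ) (a b : ℤ)
    [C.IsStrictlyGE a] [C.IsStrictlyLE b] : bounded P C :=
  ⟨|a| + |b|, fun i hi => by
    by_cases h : i < a
    · exact C.isZero_of_isStrictlyGE a i h
    · exact C.isZero_of_isStrictlyLE b i (by grind)⟩

variable (P) in
lemma bdd_le_minusB : bdd P ≤ minusB P := by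
  rintro X ⟨C, ⟨N, hN⟩, ⟨e⟩⟩
  refine ⟨C, ⟨⟨N, fun i hi => hN i (hi.trans_le (le_abs_self i))⟩, fun A => ⟨N.toNat, ?_⟩⟩, ⟨e⟩⟩
  intro n hn
  rw [exactAt_homFrom_iff]
  exact fun x _ => ⟨0, (hN n (by lia)).eq_of_tgt _ _⟩

/-- If the target lives in degrees at most `N`, it equals its truncation `σ^{≤ N}`, so by naturality
the map factors through `σ^{≤ N}` of the source, which is bounded on both sides. -/
lemma exists_factorization {X Y : K P} (f : X ⟶ Y) (hX : bddBelow P X) (hY : minusB P Y) :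
    ∃ (Z : K P) (a : X ⟶ Z) (b : Z ⟶ Y), bdd P Z ∧ a ≫ b = f := by
  obtain ⟨C, a, _, ⟨eX⟩⟩ := exists_of_bddBelow hX
  obtain ⟨D, ⟨⟨N, hN⟩, _⟩, ⟨eY⟩⟩ := hY
  have : D.IsStrictlyLE N := (D.isStrictlyLE_iff N).2 hN
  obtain ⟨g, hg⟩ := (HomotopyCategory.quotient P (ComplexShape.up ℤ)).map_surjective
    (eX.inv ≫ f ≫ eY.inv)
  let e := ComplexShape.embeddingUpIntLE N
  have : IsIso (πStupidTrunc D e) := isIso_πStupidTrunc D e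
  have hC : CochainComplex.IsStrictlyGE (C.stupidTrunc e) a := inferInstance
  have hC' : CochainComplex.IsStrictlyLE (C.stupidTrunc e) N := inferInstance
  let q := HomotopyCategory.quotient P (ComplexShape.up ℤ)
  refine ⟨q.obj (C.stupidTrunc e), eX.hom ≫ q.map (πStupidTrunc C e),
    q.map (HomologicalComplex.stupidTruncMap g e ≫ inv (πStupidTrunc D e)) ≫ eY.hom,
    ⟨_, bounded_of_isStrictlyGE_of_isStrictlyLE _ a N, ⟨Iso.refl _⟩⟩, ?_⟩
  rw [Category.assoc, ← q.map_comp_assoc, ← Category.assoc (πStupidTrunc C e),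
    ← πStupidTrunc_naturality, Category.assoc, IsIso.hom_inv_id,
    Category.comp_id, hg]
  simp

/-! ### Comparison of the two Verdier quotients. -/

lemma bdd_le_bddBelow : bdd P ≤ bddBelow P := by
  rintro X ⟨C, ⟨N, hN⟩, ⟨e⟩⟩
  have : C.IsStrictlyGE (-N) := (C.isStrictlyGE_iff _).2 fun i hi => hN i (by grind)
  exact ObjectProperty.prop_of_iso _ e (bddBelow_of_isStrictlyGE C (-N))

/-- Verdier's criterion, the source of full faithfulness of `comparison`. -/
instance : (minusB P).IsVerdierRightLocalizing (bddBelow P) where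
  fac f hX hY := by
    obtain ⟨Z, a, b, hZ, fac⟩ := exists_factorization f hX hY
    exact ⟨Z, a, b, bdd_le_minusB P _ hZ, bdd_le_bddBelow _ hZ, fac⟩

variable (P) in
/-- The objects of `KminusB P` which are isomorphic to a bounded below cochain complex. -/
abbrev bddBelowInMinusB : ObjectProperty (KminusB P) := (bddBelow P).inverseImage (minusB P).ι

lemma isZero_toVerdierQuotient_obj_of_bdd (X : KminusB P) (hX : bddInMinusB P X) :
    IsZero ((toVerdierQuotient P).obj X) := by
  -- The cone of `X ⟶ 0` is `X⟦1⟧`, again bounded.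
  have : IsIso ((toVerdierQuotient P).map (0 : X ⟶ 0)) := by
    refine Localization.inverts _ (bddInMinusB P).trW _ ?_
    exact ((bddInMinusB P).trW_iff _).2 ⟨_, _, _, contractible_distinguished₂ X,
      (bddInMinusB P).le_shift _ _ hX⟩
  exact ((toVerdierQuotient P).map_isZero (isZero_zero _)).of_iso
    (asIso ((toVerdierQuotient P).map (0 : X ⟶ 0)))

/-- A bounded below object of `KminusB P` is zero in the Verdier quotient, because its identity
factors through a bounded complex. -/
lemma isZero_toVerdierQuotient_obj (X : KminusB P) (hX : bddBelowInMinusB P X) :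
    IsZero ((toVerdierQuotient P).obj X) := by
  obtain ⟨Z, a, b, hZ, fac⟩ := exists_factorization (𝟙 X.obj) hX X.property
  let Z' : KminusB P := ⟨Z, bdd_le_minusB P _ hZ⟩
  let a' : X ⟶ Z' := (minusB P).homMk a
  let b' : Z' ⟶ X := (minusB P).homMk b
  have fac' : a' ≫ b' = 𝟙 X := by ext; exact fac
  rw [IsZero.iff_id_eq_zero, ← (toVerdierQuotient P).map_id, ← fac', Functor.map_comp,
    (isZero_toVerdierQuotient_obj_of_bdd Z' hZ).eq_of_tgt ((toVerdierQuotient P).map a') 0,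
    zero_comp]

lemma isInvertedBy_toVerdierQuotient :
    (bddBelowInMinusB P).trW.IsInvertedBy (toVerdierQuotient P) := by
  rintro X Y f ⟨Z, g, h, hT, hZ⟩
  have := (toVerdierQuotient P).map_distinguished _ hT
  exact (Triangle.isZero₃_iff_isIso₁ _ this).1 (isZero_toVerdierQuotient_obj Z hZ)

lemma trW_bddInMinusB_le : (bddInMinusB P).trW ≤ (bddBelowInMinusB P).trW :=
  ObjectProperty.trW_monotone fun _ hX => bdd_le_bddBelow _ hX

/-- The localized category with respect to `W` is also the localization with respect to any larger
class of morphisms which are already inverted. -/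
lemma isLocalization_Q_of_le {C : Type*} [Category* C] {W W' : MorphismProperty C} (hW : W ≤ W')
    (hW' : W'.IsInvertedBy W.Q) : W.Q.IsLocalization W' :=
  .mk' _ _
    { inverts := hW'
      lift F hF := Localization.Construction.lift F fun _ _ f hf => hF f (hW f hf)
      fac F _ := Localization.Construction.fac F _
      uniq := Localization.Construction.uniq }
    { inverts := hW'
      lift F hF := Localization.Construction.lift F fun _ _ f hf => hF f (hW f hf)
      fac F _ := Localization.Construction.fac F _
      uniq := Localization.Construction.uniq }

/-- Verdier's criterion concerns the quotient by `bddBelowInMinusB P`, whose objects are only shown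
to be retracts of bounded complexes. Such retracts already vanish in the quotient by `bddInMinusB
P`, so the same functor localizes for both. -/
instance isLocalization_toVerdierQuotient :
    (toVerdierQuotient P).IsLocalization (bddBelowInMinusB P).trW :=
  isLocalization_Q_of_le trW_bddInMinusB_le isInvertedBy_toVerdierQuotient

variable (P)

/-- The Verdier quotient of the homotopy category by the bounded below cochain complexes. -/
abbrev BddBelowQuotient := (bddBelow P).trW.Localization

/-- The natural functor from the homotopy category to the quotient by the bounded below cochain
complexes. -/
abbrev toBddBelowQuotient : K P ⥤ BddBelowQuotient P := (bddBelow P).trW.Q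

/-- The comparison functor between the quotients. -/
noncomputable abbrev comparison : VerdierQuotient P ⥤ BddBelowQuotient P :=
  ((minusB P).triangulatedLocalizerMorphism (bddBelow P)).localizedFunctor
    (toVerdierQuotient P) (toBddBelowQuotient P)

noncomputable instance : Localization.Lifting (toVerdierQuotient P) (bddBelowInMinusB P).trW
    ((minusB P).ι ⋙ toBddBelowQuotient P) (comparison P) :=
  ((minusB P).triangulatedLocalizerMorphism (bddBelow P)).liftingLocalizedFunctor
    (toVerdierQuotient P) (toBddBelowQuotient P)

noncomputable instance : (comparison P).CommShift ℤ :=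
  Functor.commShiftOfLocalization (toVerdierQuotient P) (bddBelowInMinusB P).trW ℤ
    ((minusB P).ι ⋙ toBddBelowQuotient P) (comparison P)

instance : (comparison P).IsTriangulated := by
  have := Localization.essSurj_mapArrow (toVerdierQuotient P) (bddBelowInMinusB P).trW
  exact Functor.isTriangulated_of_precomp_iso
    (Localization.Lifting.iso (toVerdierQuotient P) (bddBelowInMinusB P).trW
      ((minusB P).ι ⋙ toBddBelowQuotient P) (comparison P))

end BrutalTruncation

namespace BrutalTruncation

/-! ### Construction of the functor and its properties. -/

variable (P : Type u) [Category.{v} P] [Preadditive P] [HasZeroObject P] [HasBinaryBiproducts P]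

/-- The functor from the homotopy category of totally acyclic complexes to the quotient of the
homotopy category by the bounded below cochain complexes. -/
noncomputable abbrev tacToBddBelowQuotient : Ktac P ⥤ BddBelowQuotient P :=
  (tac P).ι ⋙ toBddBelowQuotient P

/-- Morphisms out of an object left orthogonal to the subcategory being killed do not change in the
quotient. -/
lemma tacToBddBelowQuotient_map_bijective (X Y : Ktac P) :
    Function.Bijective ((tacToBddBelowQuotient P).map : (X ⟶ Y) → _) :=
  (ObjectProperty.leftOrthogonal.map_bijective_of_isTriangulated
    (tac_le_leftOrthogonal _ X.property) (toBddBelowQuotient P) Y.obj).comp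
      ((tac P).fullyFaithfulι.map_bijective X Y)

instance : (tacToBddBelowQuotient P).Full where
  map_surjective := (tacToBddBelowQuotient_map_bijective P _ _).2

instance : (tacToBddBelowQuotient P).Faithful where
  map_injective h := (tacToBddBelowQuotient_map_bijective P _ _).1 h

/-- In the quotient by the bounded below cochain complexes, any complex is naturally isomorphic to
its brutal truncation. -/
noncomputable def brutalTruncIso :
    HomotopyCategory.quotient P (ComplexShape.up ℤ) ⋙ toBddBelowQuotient P ≅
      brutalTrunc P ⋙ HomotopyCategory.quotient P (ComplexShape.up ℤ) ⋙ toBddBelowQuotient P :=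
  NatIso.ofComponents (fun C => Localization.isoOfHom (toBddBelowQuotient P) (bddBelow P).trW _
    (trW_map_πStupidTrunc C 0)) fun {C D} f => by
      let F := HomotopyCategory.quotient P (ComplexShape.up ℤ) ⋙ toBddBelowQuotient P
      exact (F.map_comp _ _).symm.trans
        ((congrArg F.map (πStupidTrunc_naturality f _)).trans (F.map_comp _ _))

/-- In the quotient by the bounded below cochain complexes, totally acyclic complexes are naturally
isomorphic to their brutal truncations. -/
noncomputable def truncToQuotientCompComparison :
    toKtac P ⋙ tacToBddBelowQuotient P ≅ truncToQuotient P ⋙ comparison P :=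
  Functor.isoWhiskerLeft (totallyAcyclic P).ι (brutalTruncIso P) ≪≫
    Functor.isoWhiskerLeft ((minusB P).lift ((totallyAcyclic P).ι ⋙ brutalTrunc P ⋙
        HomotopyCategory.quotient P (ComplexShape.up ℤ))
      (fun C => brutalTrunc_mem C.obj C.property))
      (Localization.Lifting.iso (toVerdierQuotient P) (bddBelowInMinusB P).trW
        ((minusB P).ι ⋙ toBddBelowQuotient P) (comparison P)).symm

variable {P} in
/-- The totally acyclic complex underlying an object of `Ktac P`. -/
def representative (X : Ktac P) : (totallyAcyclic P).FullSubcategory where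
  obj := X.obj.as
  property := by
    -- Total acyclicity is orthogonality to stalks, hence homotopy invariant, so the complex
    -- underlying `X` is itself totally acyclic.
    exact (totallyAcyclic_iff _).2 ((tac_eq P).le _ X.property)

/-- The component of `truncToQuotientCompComparison` at a representative of an object. -/
noncomputable def comparisonTruncIso (X : Ktac P) :
    (comparison P).obj ((truncToQuotient P).obj (representative X)) ≅
      (tacToBddBelowQuotient P).obj X :=
  (truncToQuotientCompComparison P).symm.app (representative X)

/-- The functor from the homotopy category of totally acyclic complexes to the Verdier quotient
induced by brutal truncation. -/
noncomputable def tacToVerdierQuotient : Ktac P ⥤ VerdierQuotient P where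
  obj X := (truncToQuotient P).obj (representative X)
  map {X Y} f := (comparison P).preimage ((comparisonTruncIso P X).hom ≫
    (tacToBddBelowQuotient P).map f ≫ (comparisonTruncIso P Y).inv)
  map_id X := (comparison P).map_injective (by simp)
  map_comp f g := (comparison P).map_injective (by simp)

/-- Equality holds strictly on objects because `representative` returns the given complex. On maps
it is tested after the faithful `comparison`, where it is naturality of the truncation isomorphism.
-/
lemma toKtac_comp_tacToVerdierQuotient :
    toKtac P ⋙ tacToVerdierQuotient P = truncToQuotient P :=
  CategoryTheory.Functor.hext (fun _ => rfl) fun C D f => by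
    apply heq_of_eq
    apply (comparison P).map_injective
    exact ((comparison P).map_preimage _).trans
      (NatIso.naturality_1 (truncToQuotientCompComparison P) f)

/-- The composition of `tacToVerdierQuotient` with the comparison functor. -/
noncomputable def tacToVerdierQuotientCompComparison :
    tacToVerdierQuotient P ⋙ comparison P ≅ tacToBddBelowQuotient P :=
  NatIso.ofComponents (comparisonTruncIso P) fun f => by
    simp [tacToVerdierQuotient]

instance : (tacToVerdierQuotient P).Full :=
  CategoryTheory.Functor.Full.of_comp_faithful_iso (tacToVerdierQuotientCompComparison P)

instance : (tacToVerdierQuotient P).Faithful :=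
  CategoryTheory.Functor.Faithful.of_comp_iso (tacToVerdierQuotientCompComparison P)

/-- Brutal truncation at a fixed degree does not commute with shifts of complexes; the shift
structure is pulled back from `tacToBddBelowQuotient` through the fully faithful `comparison`. -/
noncomputable instance : (tacToVerdierQuotient P).CommShift ℤ :=
  .ofComp (tacToVerdierQuotientCompComparison P) ℤ

instance : NatTrans.CommShift (tacToVerdierQuotientCompComparison P).hom ℤ :=
  Functor.CommShift.ofComp_compatibility (tacToVerdierQuotientCompComparison P) ℤ

instance : (tacToVerdierQuotient P).IsTriangulated :=
  (Functor.isTriangulated_iff_comp_right (tacToVerdierQuotientCompComparison P)).2 inferInstance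

end BrutalTruncation

theorem theorem2p2 (P : Type u) [Category.{v} P] [Preadditive P] [HasZeroObject P]
    [HasBinaryBiproducts P] :
    ∃ (β : BrutalTruncation.Ktac P ⥤ BrutalTruncation.VerdierQuotient P) (_ : β.CommShift ℤ),
      BrutalTruncation.toKtac P ⋙ β = BrutalTruncation.truncToQuotient P ∧
        β.IsTriangulated ∧ β.Full ∧ β.Faithful :=
  ⟨BrutalTruncation.tacToVerdierQuotient P, inferInstance,
    BrutalTruncation.toKtac_comp_tacToVerdierQuotient P, inferInstance, inferInstance,
    inferInstance⟩
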